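/- Let $a\neq b$ be two letters, let $\alpha$ be an irrational number with $0<\alpha<1/2$, and let $[0;d_0+1,d_1,d_2,\dots]$ be its continued fraction expansion, so that $d_n\ge 1$ for all $n\ge 0$. Let $(s_n)_{n\ge -1}$ be the standard sequence of words defined by $s_{-1}=b$, $s_0=a$ and $s_{n+1}=s_n^{d_n}s_{n-1}$ for $n\ge 0$, and let $w$ be the standard Sturmian word of slope $\alpha$, that is, the infinite word to which $(s_n)$ converges. Call a finite word $v$ \emph{semicentral} if its longest repeated prefix (the longest prefix with at least two occurrences in $v$), its longest repeated suffix, its longest left special factor and its longest right special factor all exist, are unique, and coincide; here a factor $u$ of $v$ is left special (resp. right special) in $v$ if $cu$ and $du$ (resp. $uc$ and $ud$) are factors of $v$ for two distinct letters $c,d$. Then for every $n\ge 1$ one has $s_n=u_nx_ny_n$ for a word $u_n$, where $x_ny_n=ab$ if $n$ is odd and $x_ny_n=ba$ if $n$ is even; and a finite word is a semicentral prefix of $w$ if and only if it equals $u_nx_ny_nu_n$ for some $n\ge 1$. -/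

import Mathlib

namespace SturmianOC

variable {A : Type*}

/-! ### Finite words, factors, special factors (words are lists of letters) -/

/-- The word `u` is repeated in `v`: it has at least two distinct occurrences in `v`, an occurrence
being a factorization `v = p ++ u ++ z`. -/
def IsRepeatedIn (u v : List A) : Prop :=
  ∃ p z p' z' : List A, v = p ++ u ++ z ∧ v = p' ++ u ++ z' ∧ p ≠ p'

/-- `u` is a prefix of `v` that is repeated in `v`. -/
def IsRepeatedPrefix (u v : List A) : Prop := u <+: v ∧ IsRepeatedIn u v

/-- `u` is a suffix of `v` that is repeated in `v`. -/
def IsRepeatedSuffix (u v : List A) : Prop := u <:+ v ∧ IsRepeatedIn u v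

/-- `u` is left special in `v`: `cu` and `du` are factors of `v` for two different letters. -/
def IsLeftSpecial (u v : List A) : Prop :=
  ∃ c d : A, c ≠ d ∧ (c :: u) <:+: v ∧ (d :: u) <:+: v

/-- `u` is right special in `v`: `uc` and `ud` are factors of `v` for two different letters. -/
def IsRightSpecial (u v : List A) : Prop :=
  ∃ c d : A, c ≠ d ∧ (u ++ [c]) <:+: v ∧ (u ++ [d]) <:+: v

/-- `u` is the longest word with property `P`: it has `P`, and every other word with `P` is
strictly shorter. -/
def IsTheLongest (P : List A → Prop) (u : List A) : Prop :=
  P u ∧ ∀ t : List A, P t → t ≠ u → t.length < u.length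

/-- A word `v` is semicentral if its longest repeated prefix, its longest repeated suffix, its
longest left special factor and its longest right special factor (exist and) coincide. -/
def IsSemicentral (v : List A) : Prop :=
  ∃ u : List A,
    IsTheLongest (fun t => IsRepeatedPrefix t v) u ∧
    IsTheLongest (fun t => IsRepeatedSuffix t v) u ∧
    IsTheLongest (fun t => IsLeftSpecial t v) u ∧
    IsTheLongest (fun t => IsRightSpecial t v) u

/-! ### Infinite words -/

/-- The finite word `v` is a prefix of the infinite word `w = w 0, w 1, w 2, …`. -/
def IsPrefixOf (v : List A) (w : ℕ → A) : Prop :=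
  ∀ (i : ℕ) (h : i < v.length), v[i] = w i

/-- The sequence of finite words `s` converges to the infinite word `w`: for every position `k`,
all but finitely many `s n` have a letter at position `k`, and it is `w k`. -/
def ConvergesTo (s : ℕ → List A) (w : ℕ → A) : Prop :=
  ∀ k : ℕ, ∀ᶠ n in Filter.atTop, (s n)[k]? = some (w k)

/-! ### Standard sequences -/

/-- The partial quotient `q_(n+1)` in `α = [q_0; q_1, q_2, …]`, as a natural number. (For irrational
`α` all of them exist and are positive integers.) -/
noncomputable def partialQuotient (α : ℝ) (n : ℕ) : ℕ :=
  ⌊((GenContFract.of α).partDens.get? n).getD 0⌋₊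

/-- The numbers `d_0, d_1, …` with `α = [0; d_0 + 1, d_1, d_2, …]`, for irrational `0 < α < 1`. -/
noncomputable def slopeDigit (α : ℝ) : ℕ → ℕ
  | 0 => partialQuotient α 0 - 1
  | n + 1 => partialQuotient α (n + 1)

/-- The standard sequence with its index shifted by one: the value at `n` is `s_(n-1)`, where
`s_(-1) = b`, `s_0 = a` and `s_(n+1) = s_n ^ (d_n) s_(n-1)`. -/
def shiftedStandardSeq (d : ℕ → ℕ) (a b : A) : ℕ → List A
  | 0 => [b]
  | 1 => [a]
  | n + 2 => (List.replicate (d n) (shiftedStandardSeq d a b (n + 1))).flatten ++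
      shiftedStandardSeq d a b n

/-- The word `s_n`, `n ≥ 0`, of the standard sequence of slope `α` over the letters `a`, `b`. -/
noncomputable def standardSeq (α : ℝ) (a b : A) (n : ℕ) : List A :=
  shiftedStandardSeq (slopeDigit α) a b (n + 1)

/-- `w` is the standard Sturmian word of slope `α` over the letters `a`, `b`: the limit of the
standard sequence. -/
def IsStandardSturmianWord (α : ℝ) (a b : A) (w : ℕ → A) : Prop :=
  ConvergesTo (standardSeq α a b) w

/-- The two-letter word `xy` that goes with `s_n`: `ab` if `n` is odd and `ba` if `n` is even. -/
def lastTwo (a b : A) (n : ℕ) : List A := if Odd n then [a, b] else [b, a]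

/-- The word `u_n` that is left of `s_n` when its last two letters are removed (`n ≥ 1`). -/
noncomputable def centralPrefix (α : ℝ) (a b : A) (n : ℕ) : List A :=
  (standardSeq α a b n).dropLast.dropLast

/-! ### The standard Sturmian word of slope `α` exists and is unique -/

theorem partialQuotient_pos {α : ℝ} (hα : Irrational α) (n : ℕ) : 0 < partialQuotient α n := by
  have hnt : ¬ (GenContFract.of α).TerminatedAt n := fun h => by
    obtain ⟨q, hq⟩ := (GenContFract.terminates_iff_rat α).1 ⟨n, h⟩
    exact hα ⟨q, hq.symm⟩
  rw [GenContFract.terminatedAt_iff_partDen_none] at hnt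
  obtain ⟨q, hq⟩ := Option.ne_none_iff_exists'.1 hnt
  have h1 := GenContFract.of_one_le_get?_partDen hq
  simpa [partialQuotient, hq, Nat.floor_pos] using h1

theorem standardSeq_step {α : ℝ} (hα : Irrational α) (a b : A) (n : ℕ) :
    ∃ t, t ≠ [] ∧ standardSeq α a b (n + 2) = standardSeq α a b (n + 1) ++ t := by
  have hne : ∀ m, shiftedStandardSeq (slopeDigit α) a b m ≠ [] := by
    intro m
    induction m using Nat.twoStepInduction with
    | zero => simp [shiftedStandardSeq]
    | one => simp [shiftedStandardSeq]
    | more m h _ => simp [shiftedStandardSeq, h]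
  obtain ⟨k, hk⟩ := Nat.exists_eq_succ_of_ne_zero (partialQuotient_pos hα (n + 1)).ne'
  refine ⟨(List.replicate k (standardSeq α a b (n + 1))).flatten ++ standardSeq α a b n, ?_, ?_⟩
  · simp only [ne_eq, List.append_eq_nil_iff, not_and]
    exact fun _ => hne _
  · simp only [standardSeq, shiftedStandardSeq, slopeDigit, hk, Nat.succ_eq_add_one,
      List.replicate_succ, List.flatten_cons, List.append_assoc]

theorem existsUnique_standardSturmianWord {α : ℝ} (hα : Irrational α) (a b : A) :
    ∃! w : ℕ → A, IsStandardSturmianWord α a b w := by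
  have hlen : ∀ n, n ≤ (standardSeq α a b (n + 1)).length := by
    intro n
    induction n with
    | zero => simp
    | succ n ih =>
      obtain ⟨t, ht, h⟩ := standardSeq_step hα a b n
      rw [h, List.length_append]
      have := List.length_pos_iff.2 ht
      omega
  have hpre : ∀ m n, m ≤ n → standardSeq α a b (m + 1) <+: standardSeq α a b (n + 1) := by
    intro m n hmn
    induction n, hmn using Nat.le_induction with
    | base => exact List.prefix_refl _
    | succ n _ ih =>
      obtain ⟨t, _, h⟩ := standardSeq_step hα a b n
      exact ih.trans ⟨t, h.symm⟩
  refine ⟨fun k => (standardSeq α a b (k + 2))[k]'(hlen (k + 1)), ?_, ?_⟩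
  · intro k
    filter_upwards [Filter.eventually_ge_atTop (k + 2)] with n hn
    obtain ⟨m, rfl⟩ : ∃ m, n = m + 1 := ⟨n - 1, by omega⟩
    obtain ⟨t, ht⟩ := hpre (k + 1) m (by omega)
    rw [← ht, List.getElem?_append_left (hlen (k + 1))]
    exact List.getElem?_eq_getElem (hlen (k + 1))
  · intro w hw
    funext k
    obtain ⟨n, hn, hk⟩ := ((hw k).and (Filter.eventually_ge_atTop (k + 2))).exists
    obtain ⟨m, rfl⟩ : ∃ m, n = m + 1 := ⟨n - 1, by omega⟩
    obtain ⟨t, ht⟩ := hpre (k + 1) m (by omega)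
    rw [← ht, List.getElem?_append_left (hlen (k + 1)),
      List.getElem?_eq_getElem (hlen (k + 1))] at hn
    exact (Option.some.inj hn).symm

end SturmianOC

/-! The proof is a descent along the morphism ψ: a ↦ a, c ↦ ac for c ≠ a. Put φ(v) = ψ(v)a. In φ(v)
every letter other than a stands between two a's, and every a starts φ(r) for some suffix r of v.
Hence t is a repeated prefix or a left special factor of v exactly when φ(t) is one of φ(v), and
every other nonempty one of φ(v) is a prefix of such a φ(t). As φ commutes with reversal, the same
holds on the right. So φ preserves and reflects semicentrality, provided that the left special
factors of v, and those of its reversal, are comparable as prefixes (`isLeftCore_phi_iff`); factors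
of standard words have this property.

On the arithmetic side, ψ raises d_0 by one (`shiftedStandardSeq_eq_psi`), and d_0 = 0 amounts to
exchanging the letters and shifting the digits (`shiftedStandardSeq_swap`). Moreover φ maps s_n u_n
to the corresponding word for the raised digit. Both descriptions therefore descend together, by
induction on length (`isSemicentral_limitPrefix_iff`); once d_0 ≥ 1, the only word that does not
descend is ab. -/

namespace SturmianOC

variable {A : Type*}

/-! ### The morphism `a ↦ a`, `c ↦ ac` -/

open scoped Classical in
/-- The morphism that fixes `a` and maps every other letter `c` to `ac`. -/
noncomputable def psi (a : A) (v : List A) : List A :=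
  v.flatMap fun c => if c = a then [a] else [a, c]

/-- The image of `v` under `psi a`, completed by the letter `a`. -/
noncomputable def phi (a : A) (v : List A) : List A := psi a v ++ [a]

@[simp] theorem psi_nil (a : A) : psi a [] = [] := rfl

@[simp] theorem psi_append (a : A) (u v : List A) : psi a (u ++ v) = psi a u ++ psi a v := by
  simp [psi]

@[simp] theorem psi_cons_self (a : A) (v : List A) : psi a (a :: v) = a :: psi a v := by
  simp [psi]

theorem psi_cons_of_ne {a c : A} (h : c ≠ a) (v : List A) : psi a (c :: v) = a :: c :: psi a v := by
  simp [psi, h]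

theorem exists_psi_cons (a c : A) (v : List A) : ∃ z, psi a (c :: v) = a :: z := by
  by_cases h : c = a
  · subst h; exact ⟨_, psi_cons_self _ _⟩
  · exact ⟨_, psi_cons_of_ne h v⟩

theorem exists_phi_eq_cons (a : A) (v : List A) : ∃ z, phi a v = a :: z := by
  cases v with
  | nil => exact ⟨[], rfl⟩
  | cons c v =>
    obtain ⟨z, hz⟩ := exists_psi_cons a c v
    exact ⟨z ++ [a], by simp [phi, hz]⟩

theorem phi_append (a : A) (u v : List A) : phi a (u ++ v) = psi a u ++ phi a v := by
  simp [phi]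

theorem length_le_length_psi (a : A) (v : List A) : v.length ≤ (psi a v).length := by
  induction v with
  | nil => simp
  | cons c v ih =>
    by_cases h : c = a
    · subst h; simpa using ih
    · rw [psi_cons_of_ne h]; simp; omega

theorem length_lt_length_phi (a : A) (v : List A) : v.length < (phi a v).length := by
  have := length_le_length_psi a v
  simp [phi]; omega

/-- The second letter decodes the first block: every block starts with a, so a second letter other
than a must belong to the first block. -/
theorem psi_injective (a : A) : Function.Injective (psi a) := by
  intro u
  induction u with
  | nil =>
    intro v h
    have := length_le_length_psi a v
    rw [← h] at this
    exact (List.length_eq_zero_iff.1 (by simpa using this)).symm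
  | cons c u ih =>
    intro v h
    cases v with
    | nil => obtain ⟨z, hz⟩ := exists_psi_cons a c u; simp [hz] at h
    | cons e v =>
      by_cases hc : c = a <;> by_cases he : e = a
      · subst hc; subst he
        simp only [psi_cons_self, List.cons.injEq, true_and] at h
        rw [ih h]
      · subst hc
        rw [psi_cons_self, psi_cons_of_ne he] at h
        cases u with
        | nil => simp at h
        | cons f u =>
          obtain ⟨z, hz⟩ := exists_psi_cons c f u
          simp only [hz, List.cons.injEq, true_and] at h
          exact absurd h.1.symm he
      · subst he
        rw [psi_cons_self, psi_cons_of_ne hc] at h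
        cases v with
        | nil => simp at h
        | cons f v =>
          obtain ⟨z, hz⟩ := exists_psi_cons e f v
          simp only [hz, List.cons.injEq, true_and] at h
          exact absurd h.1 hc
      · rw [psi_cons_of_ne hc, psi_cons_of_ne he] at h
        simp only [List.cons.injEq, true_and] at h
        rw [h.1, ih h.2]

theorem phi_injective (a : A) : Function.Injective (phi a) := fun _ _ h =>
  psi_injective a (List.append_cancel_right h)

/-- The final a of φ(u) is the first letter of φ of whatever follows u. -/
theorem phi_prefix {a : A} {u v : List A} (h : u <+: v) : phi a u <+: phi a v := by
  obtain ⟨z, rfl⟩ := h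
  obtain ⟨y, hy⟩ := exists_phi_eq_cons a z
  exact ⟨y, by rw [phi_append, hy]; simp [phi]⟩

theorem phi_infix {a : A} {u v : List A} (h : u <:+: v) : phi a u <:+: phi a v := by
  obtain ⟨p, z, rfl⟩ := h
  rw [List.append_assoc, phi_append]
  exact (phi_prefix (List.prefix_append u z)).isInfix.trans (List.suffix_append _ _).isInfix

theorem phi_reverse (a : A) (v : List A) : (phi a v).reverse = phi a v.reverse := by
  induction v with
  | nil => rfl
  | cons c v ih =>
    -- Moving the extra a across a block turns the reversed block back into the block.
    have hc : a :: (psi a [c]).reverse = psi a [c] ++ [a] := by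
      by_cases h : c = a
      · subst h; simp
      · simp [psi_cons_of_ne h]
    have h1 : phi a (c :: v) = psi a [c] ++ phi a v := phi_append a [c] v
    rw [h1, List.reverse_append, ih, List.reverse_cons, phi_append]
    simp only [phi, List.append_assoc, List.singleton_append, hc]

/-- Every occurrence of `a` in `phi a v` starts the image of a suffix of `v`. -/
theorem exists_of_phi_eq_append_cons {a : A} {v P R : List A} (h : phi a v = P ++ a :: R) :
    ∃ p r, v = p ++ r ∧ P = psi a p ∧ a :: R = phi a r := by
  induction v generalizing P with
  | nil =>
    have hP : P = [] := by
      have := congrArg List.length h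
      simp [phi] at this
      exact List.length_eq_zero_iff.1 (by omega)
    subst hP
    exact ⟨[], [], rfl, rfl, h.symm⟩
  | cons c v ih =>
    cases P with
    | nil => exact ⟨[], c :: v, rfl, rfl, h.symm⟩
    | cons e P =>
      by_cases hc : c = a
      · subst hc
        simp only [phi, psi_cons_self, List.cons_append, List.cons.injEq] at h
        obtain ⟨p, r, rfl, rfl, hr⟩ := ih h.2
        exact ⟨c :: p, r, rfl, by simp [h.1], hr⟩
      · simp only [phi, psi_cons_of_ne hc, List.cons_append, List.cons.injEq] at h
        obtain ⟨rfl, h⟩ := h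
        cases P with
        | nil => simp only [List.nil_append, List.cons.injEq] at h; exact absurd h.1 hc
        | cons f P =>
          simp only [List.cons_append, List.cons.injEq] at h
          obtain ⟨rfl, h⟩ := h
          obtain ⟨p, r, rfl, rfl, hr⟩ := ih h
          exact ⟨c :: p, r, rfl, by simp [psi_cons_of_ne hc], hr⟩

/-- In `phi a v`, a letter other than `a` is preceded and followed by `a`. -/
theorem exists_of_phi_eq_append_cons_of_ne {a c : A} (hc : c ≠ a) {v P R : List A}
    (h : phi a v = P ++ c :: R) : (∃ P', P = P' ++ [a]) ∧ ∃ R', R = a :: R' := by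
  induction v generalizing P with
  | nil =>
    cases P with
    | nil => simp [phi] at h; exact absurd h.1.symm hc
    | cons e P => simp [phi] at h
  | cons e v ih =>
    cases P with
    | nil =>
      obtain ⟨z, hz⟩ := exists_phi_eq_cons a (e :: v)
      rw [hz] at h
      simp only [List.nil_append, List.cons.injEq] at h
      exact absurd h.1.symm hc
    | cons f P =>
      by_cases he : e = a
      · subst he
        simp only [phi, psi_cons_self, List.cons_append, List.cons.injEq] at h
        obtain ⟨⟨P', rfl⟩, hR⟩ := ih h.2
        exact ⟨⟨f :: P', rfl⟩, hR⟩
      · simp only [phi, psi_cons_of_ne he, List.cons_append, List.cons.injEq] at h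
        obtain ⟨rfl, h⟩ := h
        cases P with
        | nil =>
          simp only [List.nil_append, List.cons.injEq] at h
          obtain ⟨z, hz⟩ := exists_phi_eq_cons a v
          exact ⟨⟨[], rfl⟩, z, by rw [← h.2]; exact hz⟩
        | cons g P =>
          simp only [List.cons_append, List.cons.injEq] at h
          obtain ⟨⟨P', rfl⟩, hR⟩ := ih h.2
          exact ⟨⟨a :: g :: P', rfl⟩, hR⟩

/-- Occurrences of `phi a t` in `phi a v` come from occurrences of `t` in `v`. -/
theorem exists_of_phi_eq_append_phi {a : A} {v t P Z : List A} (h : phi a v = P ++ phi a t ++ Z) :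
    ∃ p z, v = p ++ t ++ z ∧ P = psi a p ∧ a :: Z = phi a z := by
  obtain ⟨y, hy⟩ := exists_phi_eq_cons a t
  obtain ⟨q, z, rfl, hq, hz⟩ := exists_of_phi_eq_append_cons (P := P ++ psi a t) (R := Z)
    (by rw [h]; simp [phi])
  obtain ⟨p, r, -, rfl, -⟩ := exists_of_phi_eq_append_cons (P := P) (R := y ++ Z)
    (by rw [h, hy]; simp)
  rw [← psi_append] at hq
  exact ⟨p, z, by rw [psi_injective a hq], rfl, hz⟩

theorem phi_infix_iff {a : A} {t v : List A} : phi a t <:+: phi a v ↔ t <:+: v := by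
  refine ⟨?_, phi_infix⟩
  rintro ⟨P, Z, h⟩
  obtain ⟨p, z, rfl, -, -⟩ := exists_of_phi_eq_append_phi h.symm
  exact ⟨p, z, rfl⟩

/-- If c = a, the left side is already about φ(ct); otherwise c is always preceded by a, and acφ(t)
= φ(ct). Thus φ keeps the set of left extensions. -/
theorem cons_phi_infix_iff {a c : A} {t v : List A} :
    (c :: phi a t) <:+: phi a v ↔ (c :: t) <:+: v := by
  rw [← phi_infix_iff (a := a) (t := c :: t)]
  by_cases hc : c = a
  · subst hc; simp [phi]
  · have h : phi a (c :: t) = a :: c :: phi a t := by simp [phi, psi_cons_of_ne hc]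
    rw [h]
    constructor
    · rintro ⟨P, Z, hP⟩
      obtain ⟨⟨P', rfl⟩, -⟩ := exists_of_phi_eq_append_cons_of_ne hc (v := v) (P := P)
        (R := phi a t ++ Z) (by rw [← hP]; simp)
      exact ⟨P', Z, by rw [← hP]; simp⟩
    · exact fun h => (List.suffix_cons _ _).isInfix.trans h

/-- A nonempty factor of `phi a v` that starts with `a` extends to the right to some `phi a t`. -/
theorem exists_phi_of_cons {a : A} {x : List A} {v : List A} (h : (a :: x) <:+: phi a v) :
    ∃ t, a :: x = phi a t ∨ (a :: x = psi a t ∧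
      ∀ P Z, phi a v = P ++ (a :: x) ++ Z → ∃ Z', Z = a :: Z') := by
  obtain ⟨P, Z, h⟩ := h
  obtain ⟨p, r, rfl, rfl, hr⟩ := exists_of_phi_eq_append_cons (P := P) (R := x ++ Z) (v := v)
    (a := a) (by rw [← h]; simp)
  rcases List.eq_nil_or_concat (a :: x) with hx | ⟨y, c, hx⟩
  · simp at hx
  rw [List.concat_eq_append] at hx
  have hr' : phi a r = y ++ c :: Z := by
    rw [← hr, ← List.cons_append, hx]; simp
  by_cases hc : c = a
  · subst hc
    obtain ⟨t, -, -, rfl, -⟩ := exists_of_phi_eq_append_cons hr'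
    exact ⟨t, Or.inl hx⟩
  · obtain ⟨-, Z', rfl⟩ := exists_of_phi_eq_append_cons_of_ne hc hr'
    obtain ⟨t, -, -, ht, -⟩ := exists_of_phi_eq_append_cons (P := y ++ [c]) (R := Z') (v := r)
      (a := a) (by rw [hr']; simp)
    refine ⟨t, Or.inr ⟨hx.trans ht, fun P Z hP => ?_⟩⟩
    exact (exists_of_phi_eq_append_cons_of_ne hc (v := p ++ r) (P := P ++ y) (R := Z)
      (by rw [hP, hx]; simp)).2

/-! ### Left special factors and repeated prefixes of `phi a v` -/

/-- Any two left special factors of `v` are comparable as prefixes. -/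
def LeftSpecialComparable (v : List A) : Prop :=
  ∀ s t, IsLeftSpecial s v → IsLeftSpecial t v → s <+: t ∨ t <+: s

theorem IsLeftSpecial.of_infix {u v v' : List A} (h : IsLeftSpecial u v) (hv : v <:+: v') :
    IsLeftSpecial u v' := by
  obtain ⟨c, d, hcd, h1, h2⟩ := h
  exact ⟨c, d, hcd, h1.trans hv, h2.trans hv⟩

theorem LeftSpecialComparable.of_infix {v v' : List A} (h : LeftSpecialComparable v')
    (hv : v <:+: v') : LeftSpecialComparable v := fun s t hs ht =>
  h s t (hs.of_infix hv) (ht.of_infix hv)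

theorem isLeftSpecial_phi_iff {a : A} {t v : List A} :
    IsLeftSpecial (phi a t) (phi a v) ↔ IsLeftSpecial t v := by
  simp only [IsLeftSpecial, cons_phi_infix_iff]

/-- A letter other than a has only a on its left, so t starts with a. If t ends in another letter,
the next letter is forced to be a, and adding it keeps both left extensions. -/
theorem IsLeftSpecial.exists_of_phi {a : A} {t v : List A} (h : IsLeftSpecial t (phi a v))
    (ht : t ≠ []) : ∃ t', IsLeftSpecial t' v ∧ t <+: phi a t' := by
  obtain ⟨c, d, hcd, h1, h2⟩ := h
  obtain ⟨e, x, rfl⟩ := List.exists_cons_of_ne_nil ht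
  have key : ∀ c, (c :: e :: x) <:+: phi a v → e ≠ a → c = a := by
    rintro c ⟨P, Z, hP⟩ he
    obtain ⟨⟨P', hP'⟩, -⟩ := exists_of_phi_eq_append_cons_of_ne he (v := v) (P := P ++ [c])
      (R := x ++ Z) (by rw [← hP]; simp)
    have := List.append_inj_right' hP' rfl
    simpa using this
  have he : e = a := by
    by_contra he
    exact hcd ((key c h1 he).trans (key d h2 he).symm)
  subst he
  have h0 : (e :: x) <:+: phi e v := (List.suffix_cons _ _).isInfix.trans h1
  obtain ⟨t, ht | ⟨ht, hZ⟩⟩ := exists_phi_of_cons h0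
  · rw [ht] at h1 h2
    exact ⟨t, isLeftSpecial_phi_iff.1 ⟨c, d, hcd, h1, h2⟩, ht ▸ List.prefix_refl _⟩
  · have ext : ∀ c, (c :: e :: x) <:+: phi e v → (c :: phi e t) <:+: phi e v := by
      rintro c ⟨P, Z, hP⟩
      obtain ⟨Z', rfl⟩ := hZ (P ++ [c]) Z (by rw [← hP]; simp)
      exact ⟨P, Z', by rw [← hP, ht]; simp [phi]⟩
    exact ⟨t, isLeftSpecial_phi_iff.1 ⟨c, d, hcd, ext c h1, ext d h2⟩, ht ▸ ⟨[e], rfl⟩⟩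

theorem LeftSpecialComparable.phi {v : List A} (h : LeftSpecialComparable v) (a : A) :
    LeftSpecialComparable (phi a v) := by
  intro s t hs ht
  rcases eq_or_ne s [] with rfl | hs0
  · exact Or.inl (List.nil_prefix)
  rcases eq_or_ne t [] with rfl | ht0
  · exact Or.inr (List.nil_prefix)
  obtain ⟨s', hs', hs⟩ := hs.exists_of_phi hs0
  obtain ⟨t', ht', ht⟩ := ht.exists_of_phi ht0
  rcases h s' t' hs' ht' with h | h
  · exact List.prefix_or_prefix_of_prefix (hs.trans (phi_prefix h)) ht
  · exact List.prefix_or_prefix_of_prefix hs (ht.trans (phi_prefix h))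

theorem isRepeatedIn_phi_iff {a : A} {t v : List A} :
    IsRepeatedIn (phi a t) (phi a v) ↔ IsRepeatedIn t v := by
  constructor
  · rintro ⟨P, Z, P', Z', h, h', hne⟩
    obtain ⟨p, z, hv, rfl, -⟩ := exists_of_phi_eq_append_phi h
    obtain ⟨p', z', hv', rfl, -⟩ := exists_of_phi_eq_append_phi h'
    exact ⟨p, z, p', z', hv, hv', fun h => hne (by rw [h])⟩
  · rintro ⟨p, z, p', z', h, h', hne⟩
    have key : ∀ p z, v = p ++ t ++ z → ∃ Z, phi a v = psi a p ++ phi a t ++ Z := by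
      rintro p z rfl
      obtain ⟨y, hy⟩ := exists_phi_eq_cons a z
      exact ⟨y, by rw [phi_append, hy]; simp [phi]⟩
    obtain ⟨Z, hZ⟩ := key p z h
    obtain ⟨Z', hZ'⟩ := key p' z' h'
    exact ⟨_, Z, _, Z', hZ, hZ', fun h => hne (psi_injective a h)⟩

theorem phi_prefix_iff {a : A} {t v : List A} : phi a t <+: phi a v ↔ t <+: v := by
  refine ⟨?_, phi_prefix⟩
  rintro ⟨Z, h⟩
  obtain ⟨p, z, rfl, hp, -⟩ := exists_of_phi_eq_append_phi (P := []) h.symm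
  obtain rfl : p = [] := psi_injective a hp.symm
  exact ⟨z, rfl⟩

theorem isRepeatedPrefix_phi_iff {a : A} {t v : List A} :
    IsRepeatedPrefix (phi a t) (phi a v) ↔ IsRepeatedPrefix t v := by
  simp only [IsRepeatedPrefix, phi_prefix_iff, isRepeatedIn_phi_iff]

theorem IsRepeatedPrefix.exists_of_phi {a : A} {t v : List A}
    (h : IsRepeatedPrefix t (phi a v)) (ht : t ≠ []) :
    ∃ t', IsRepeatedPrefix t' v ∧ t <+: SturmianOC.phi a t' := by
  obtain ⟨hp, P, Z, P', Z', h1, h2, hne⟩ := h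
  obtain ⟨e, x, rfl⟩ := List.exists_cons_of_ne_nil ht
  obtain ⟨Y, hY⟩ := hp
  obtain ⟨z, hz⟩ := exists_phi_eq_cons a v
  obtain rfl : e = a := by
    rw [hz] at hY
    simp only [List.cons_append, List.cons.injEq] at hY
    exact hY.1
  obtain ⟨t, ht | ⟨ht, hZ⟩⟩ := exists_phi_of_cons (a := e) (x := x) (v := v) ⟨[], Y, hY⟩
  · rw [ht] at h1 h2 hY
    exact ⟨t, isRepeatedPrefix_phi_iff.1 ⟨⟨Y, hY⟩, P, Z, P', Z', h1, h2, hne⟩,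
      ht ▸ List.prefix_refl _⟩
  · obtain ⟨Y, rfl⟩ := hZ [] Y hY.symm
    obtain ⟨Z, rfl⟩ := hZ P Z h1
    obtain ⟨Z', rfl⟩ := hZ P' Z' h2
    refine ⟨t, (isRepeatedPrefix_phi_iff (a := e)).1
      ⟨⟨Y, ?_⟩, P, Z, P', Z', ?_, ?_, hne⟩, ht ▸ ⟨[e], rfl⟩⟩
    · rw [← hY, ht]; simp [SturmianOC.phi]
    · rw [h1, ht]; simp [SturmianOC.phi]
    · rw [h2, ht]; simp [SturmianOC.phi]

/-- `u` is both the longest repeated prefix and the longest left special factor of `v`. -/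
def IsLeftCore (v u : List A) : Prop :=
  IsTheLongest (fun t => IsRepeatedPrefix t v) u ∧ IsTheLongest (fun t => IsLeftSpecial t v) u

theorem length_lt_of_prefix_ne {s t : List A} (h : s <+: t) (hne : s ≠ t) :
    s.length < t.length :=
  lt_of_le_of_ne h.length_le fun hl => hne (h.eq_of_length hl)

/-- φ respects the prefix order but not the comparison of lengths; comparability makes "longest"
mean "maximal for the prefix order". -/
theorem isTheLongest_phi_iff {a : A} {P Q : List A → Prop} {u : List A}
    (hPQ : ∀ t, Q (phi a t) ↔ P t) (hQ : ∀ t, Q t → t ≠ [] → ∃ t', P t' ∧ t <+: phi a t')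
    (hcomp : ∀ s t, P s → P t → s <+: t ∨ t <+: s) :
    IsTheLongest Q (phi a u) ↔ IsTheLongest P u := by
  constructor
  · rintro ⟨hu, hmax⟩
    have hPu := (hPQ u).1 hu
    refine ⟨hPu, fun t ht hne => ?_⟩
    have hlt := hmax (phi a t) ((hPQ t).2 ht) fun h => hne (phi_injective a h)
    rcases hcomp t u ht hPu with h | h
    · exact length_lt_of_prefix_ne h hne
    · exact absurd (phi_prefix (a := a) h).length_le (by omega)
  · rintro ⟨hu, hmax⟩
    refine ⟨(hPQ u).2 hu, fun t ht hne => ?_⟩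
    rcases eq_or_ne t [] with rfl | ht0
    · simp [phi]
    obtain ⟨t', ht', htt'⟩ := hQ t ht ht0
    have hpre : t' <+: u := by
      rcases eq_or_ne t' u with rfl | hne'
      · exact List.prefix_refl _
      rcases hcomp t' u ht' hu with h | h
      · exact h
      · exact absurd h.length_le (by have := hmax t' ht' hne'; omega)
    exact length_lt_of_prefix_ne (htt'.trans (phi_prefix hpre)) hne

theorem isLeftCore_phi_iff {a : A} {v u : List A} (hv : LeftSpecialComparable v) :
    IsLeftCore (phi a v) (phi a u) ↔ IsLeftCore v u :=
  and_congr
    (isTheLongest_phi_iff (fun _ => isRepeatedPrefix_phi_iff) (fun _ h h0 => h.exists_of_phi h0)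
      fun _ _ hs ht => List.prefix_or_prefix_of_prefix hs.1 ht.1)
    (isTheLongest_phi_iff (fun _ => isLeftSpecial_phi_iff) (fun _ h h0 => h.exists_of_phi h0) hv)

/-! ### Reversal -/

theorem isRepeatedIn_reverse {u v : List A} (h : IsRepeatedIn u v) :
    IsRepeatedIn u.reverse v.reverse := by
  obtain ⟨p, z, p', z', h1, h2, hne⟩ := h
  refine ⟨z.reverse, p.reverse, z'.reverse, p'.reverse, by simp [h1], by simp [h2], fun hz => hne ?_⟩
  rw [List.reverse_injective hz] at h1
  rw [h1] at h2
  simpa using h2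

theorem isRepeatedIn_reverse_iff {u v : List A} :
    IsRepeatedIn u.reverse v.reverse ↔ IsRepeatedIn u v :=
  ⟨fun h => by simpa using isRepeatedIn_reverse h, isRepeatedIn_reverse⟩

theorem isRepeatedPrefix_reverse_iff {u v : List A} :
    IsRepeatedPrefix u.reverse v.reverse ↔ IsRepeatedSuffix u v := by
  simp only [IsRepeatedPrefix, IsRepeatedSuffix, isRepeatedIn_reverse_iff, List.reverse_prefix]

theorem isLeftSpecial_reverse_iff {u v : List A} :
    IsLeftSpecial u.reverse v.reverse ↔ IsRightSpecial u v := by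
  have h : ∀ c : A, c :: u.reverse = (u ++ [c]).reverse := by simp
  simp only [IsLeftSpecial, IsRightSpecial, h, List.reverse_infix]

theorem isTheLongest_reverse_iff {P Q : List A → Prop} (h : ∀ t, P t.reverse ↔ Q t) {u : List A} :
    IsTheLongest P u.reverse ↔ IsTheLongest Q u := by
  constructor
  · rintro ⟨hu, hmax⟩
    refine ⟨(h u).1 hu, fun t ht hne => ?_⟩
    simpa using hmax t.reverse ((h t).2 ht) fun he => hne (List.reverse_injective he)
  · rintro ⟨hu, hmax⟩
    refine ⟨(h u).2 hu, fun t ht hne => ?_⟩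
    have := hmax t.reverse ((h _).1 (by simpa using ht)) fun he => hne (by simp [← he])
    simpa using this

theorem isSemicentral_iff {v : List A} :
    IsSemicentral v ↔ ∃ u, IsLeftCore v u ∧ IsLeftCore v.reverse u.reverse := by
  unfold IsSemicentral IsLeftCore
  refine exists_congr fun u => ?_
  rw [isTheLongest_reverse_iff (fun t => isRepeatedPrefix_reverse_iff (u := t) (v := v)),
    isTheLongest_reverse_iff (fun t => isLeftSpecial_reverse_iff (u := t) (v := v))]
  tauto

/-! ### Standard sequences with arbitrary digits -/

theorem psi_flatten_replicate (a : A) (k : ℕ) (x : List A) :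
    psi a (List.replicate k x).flatten = (List.replicate k (psi a x)).flatten := by
  induction k with
  | zero => rfl
  | succ k ih => simp [List.replicate_succ, ih]

/-- ψ fixes s_0 = a and maps a^k b to a^(k+1) b; from there both sequences obey the same recursion.
The index starts at s_0 because ψ(b) = ab is not s_(-1). -/
theorem shiftedStandardSeq_eq_psi {d d' : ℕ → ℕ} (h0 : d 0 = d' 0 + 1)
    (h : ∀ n, d (n + 1) = d' (n + 1)) {a b : A} (hab : a ≠ b) (m : ℕ) :
    shiftedStandardSeq d a b (m + 1) = psi a (shiftedStandardSeq d' a b (m + 1)) := by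
  induction m using Nat.twoStepInduction with
  | zero => simp [shiftedStandardSeq]
  | one =>
    simp only [shiftedStandardSeq, h0, psi_append, psi_flatten_replicate, psi_cons_self,
      psi_cons_of_ne hab.symm, psi_nil]
    rw [List.replicate_succ']
    simp
  | more m h1 h2 =>
    have e : ∀ d : ℕ → ℕ, shiftedStandardSeq d a b (m + 2 + 1) =
        (List.replicate (d (m + 1)) (shiftedStandardSeq d a b (m + 1 + 1))).flatten ++
          shiftedStandardSeq d a b (m + 1) := fun _ => rfl
    rw [e, e, psi_append, psi_flatten_replicate, ← h1, ← h2, h]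

/-- Here s_1 = s_(-1) = b, so a, b = s_0, s_1 serve as the initial pair of a sequence with exchanged
letters. -/
theorem shiftedStandardSeq_swap {d : ℕ → ℕ} (h0 : d 0 = 0) (a b : A) (m : ℕ) :
    shiftedStandardSeq d a b (m + 1) = shiftedStandardSeq (fun n => d (n + 1)) b a m := by
  induction m using Nat.twoStepInduction with
  | zero => rfl
  | one => simp [shiftedStandardSeq, h0]
  | more m h1 h2 =>
    have e : ∀ (d : ℕ → ℕ) (a b : A) (m : ℕ), shiftedStandardSeq d a b (m + 2) =
        (List.replicate (d m) (shiftedStandardSeq d a b (m + 1))).flatten ++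
          shiftedStandardSeq d a b m := fun _ _ _ _ => rfl
    rw [show m + 2 + 1 = m + 1 + 2 from rfl, e, h1, h2, e]

theorem exists_shiftedStandardSeq_succ {d : ℕ → ℕ} (hd : ∀ n, 1 ≤ d (n + 1)) (a b : A) (m : ℕ) :
    ∃ r, r ≠ [] ∧ shiftedStandardSeq d a b (m + 3) = shiftedStandardSeq d a b (m + 2) ++ r := by
  have hne : ∀ m, shiftedStandardSeq d a b m ≠ [] := by
    intro m
    induction m using Nat.twoStepInduction with
    | zero => simp [shiftedStandardSeq]
    | one => simp [shiftedStandardSeq]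
    | more m h _ => simp [shiftedStandardSeq, h]
  obtain ⟨k, hk⟩ := Nat.exists_eq_add_of_le (hd m)
  refine ⟨(List.replicate k (shiftedStandardSeq d a b (m + 2))).flatten ++
    shiftedStandardSeq d a b (m + 1), ?_, ?_⟩
  · simp [hne]
  · rw [shiftedStandardSeq, hk, Nat.add_comm 1 k, List.replicate_succ]
    simp

theorem shiftedStandardSeq_prefix {d : ℕ → ℕ} (hd : ∀ n, 1 ≤ d (n + 1)) (a b : A) {m n : ℕ}
    (hm : 2 ≤ m) (hmn : m ≤ n) : shiftedStandardSeq d a b m <+: shiftedStandardSeq d a b n := by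
  induction n, hmn using Nat.le_induction with
  | base => exact List.prefix_refl _
  | succ n hn ih =>
    obtain ⟨k, rfl⟩ : ∃ k, n = k + 2 := ⟨n - 2, by omega⟩
    obtain ⟨r, -, hr⟩ := exists_shiftedStandardSeq_succ hd a b k
    exact ih.trans ⟨r, hr.symm⟩

theorem mem_shiftedStandardSeq {d : ℕ → ℕ} {a b x : A} {m : ℕ}
    (h : x ∈ shiftedStandardSeq d a b m) : x = a ∨ x = b := by
  induction m using Nat.twoStepInduction with
  | zero => simp [shiftedStandardSeq] at h; exact Or.inr h
  | one => simp [shiftedStandardSeq] at h; exact Or.inl h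
  | more m h1 h2 =>
    rw [shiftedStandardSeq, List.mem_append, List.mem_flatten] at h
    rcases h with ⟨l, hl, hx⟩ | h
    · rw [List.eq_of_mem_replicate hl] at hx; exact h2 hx
    · exact h1 h

theorem lastTwo_add_two (a b : A) (n : ℕ) : lastTwo a b (n + 2) = lastTwo a b n := by
  simp [lastTwo, Nat.odd_add]

theorem lastTwo_succ (a b : A) (n : ℕ) : lastTwo a b (n + 1) = lastTwo b a n := by
  by_cases h : Odd n <;> simp [lastTwo, Nat.odd_add_one, h]

/-- Each word ends with the word two steps before it, so only s_1 and s_2 need inspection. The index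
m + 3 has the parity of m + 1, the true index of the word. -/
theorem lastTwo_suffix_of_pos {d : ℕ → ℕ} (hd : ∀ n, 1 ≤ d n) (a b : A) (m : ℕ) :
    lastTwo a b (m + 3) <:+ shiftedStandardSeq d a b (m + 2) := by
  have h2 : shiftedStandardSeq d a b 2 = (List.replicate (d 0) [a]).flatten ++ [b] := rfl
  induction m using Nat.twoStepInduction with
  | zero =>
    obtain ⟨k, hk⟩ := Nat.exists_eq_add_of_le (hd 0)
    refine ⟨(List.replicate k [a]).flatten, ?_⟩
    rw [h2, hk, Nat.add_comm 1 k, List.replicate_succ']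
    simp [lastTwo, show Odd 3 by decide]
  | one =>
    obtain ⟨k, hk⟩ := Nat.exists_eq_add_of_le (hd 1)
    have h3 : shiftedStandardSeq d a b 3 =
      (List.replicate (d 1) (shiftedStandardSeq d a b 2)).flatten ++ [a] := rfl
    rw [h3, hk, Nat.add_comm 1 k, List.replicate_succ', List.flatten_append]
    refine ⟨(List.replicate k (shiftedStandardSeq d a b 2)).flatten ++
      (List.replicate (d 0) [a]).flatten, ?_⟩
    simp [lastTwo, show ¬ Odd 4 by decide, h2]
  | more m h1 _ =>
    rw [show m + 2 + 3 = m + 3 + 2 from rfl, lastTwo_add_two]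
    exact h1.trans (List.suffix_append _ _)

theorem lastTwo_suffix {d : ℕ → ℕ} (hd : ∀ n, 1 ≤ d (n + 1)) (a b : A) {m : ℕ}
    (hm : 2 ≤ (shiftedStandardSeq d a b m).length) :
    lastTwo a b (m + 1) <:+ shiftedStandardSeq d a b m := by
  rcases Nat.eq_zero_or_pos (d 0) with h0 | h0
  · match m with
    | 0 => simp [shiftedStandardSeq] at hm
    | 1 => simp [shiftedStandardSeq] at hm
    | 2 => simp [shiftedStandardSeq, h0] at hm
    | m + 3 =>
      rw [shiftedStandardSeq_swap h0, lastTwo_succ]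
      exact lastTwo_suffix_of_pos hd b a m
  · match m with
    | 0 => simp [shiftedStandardSeq] at hm
    | 1 => simp [shiftedStandardSeq] at hm
    | m + 2 =>
      exact lastTwo_suffix_of_pos (fun n => by cases n with | zero => exact h0 | succ n => exact hd n)
        a b m

theorem leftSpecialComparable_singleton (c : A) : LeftSpecialComparable [c] := by
  rintro s t ⟨e, f, hef, h1, h2⟩ -
  have he := h1.subset (List.mem_cons_self)
  have hf := h2.subset (List.mem_cons_self)
  simp only [List.mem_singleton] at he hf
  exact absurd (he.trans hf.symm) hef

/-- Double descent to a single letter: lowering d_0 undoes ψ, and once d_0 = 0 the exchange of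
letters lowers the index. -/
theorem leftSpecialComparable_shiftedStandardSeq (m : ℕ) : ∀ (d : ℕ → ℕ) {a b : A}, a ≠ b →
    LeftSpecialComparable (shiftedStandardSeq d a b m) ∧
      LeftSpecialComparable (shiftedStandardSeq d a b m).reverse := by
  induction m with
  | zero =>
    intro d a b _
    exact ⟨leftSpecialComparable_singleton b, leftSpecialComparable_singleton b⟩
  | succ m ihm =>
    suffices h : ∀ (k : ℕ) (d : ℕ → ℕ), d 0 = k → ∀ {a b : A}, a ≠ b →
        LeftSpecialComparable (shiftedStandardSeq d a b (m + 1)) ∧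
          LeftSpecialComparable (shiftedStandardSeq d a b (m + 1)).reverse from
      fun d _ _ hab => h _ d rfl hab
    intro k
    induction k with
    | zero =>
      intro d h0 a b hab
      rw [shiftedStandardSeq_swap h0]
      exact ihm _ hab.symm
    | succ k ihk =>
      intro d h0 a b hab
      obtain ⟨h1, h2⟩ := ihk (Function.update d 0 k) (by simp) hab
      have hinf : shiftedStandardSeq d a b (m + 1) <:+:
          phi a (shiftedStandardSeq (Function.update d 0 k) a b (m + 1)) := by
        rw [shiftedStandardSeq_eq_psi (d' := Function.update d 0 k) (by simp [h0]) (by simp) hab]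
        exact (List.prefix_append _ _).isInfix
      refine ⟨(h1.phi a).of_infix hinf, (h2.phi a).of_infix ?_⟩
      rw [← phi_reverse]
      exact List.reverse_infix.2 hinf

/-! ### Semicentral prefixes of the limit word -/

/-- `v` is a prefix of the limit of the standard sequence with digits `d`. -/
def IsLimitPrefix (d : ℕ → ℕ) (a b : A) (v : List A) : Prop :=
  ∃ m, v <+: shiftedStandardSeq d a b (m + 2)

theorem isLimitPrefix_swap {d : ℕ → ℕ} (hd : ∀ n, 1 ≤ d (n + 1)) (h0 : d 0 = 0) {a b : A}
    {v : List A} : IsLimitPrefix d a b v ↔ IsLimitPrefix (fun n => d (n + 1)) b a v := by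
  constructor
  · rintro ⟨m, hm⟩
    refine ⟨m, ?_⟩
    rw [← shiftedStandardSeq_swap h0]
    exact hm.trans (shiftedStandardSeq_prefix hd a b (by omega) (by omega))
  · rintro ⟨m, hm⟩
    exact ⟨m + 1, by rwa [shiftedStandardSeq_swap h0]⟩

theorem IsLimitPrefix.phi {d d' : ℕ → ℕ} (h0 : d 0 = d' 0 + 1)
    (h : ∀ n, d (n + 1) = d' (n + 1)) (hd : ∀ n, 1 ≤ d' (n + 1)) {a b : A} (hab : a ≠ b)
    {v : List A} (hv : IsLimitPrefix d' a b v) : IsLimitPrefix d a b (phi a v) := by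
  obtain ⟨m, hm⟩ := hv
  refine ⟨m + 1, (phi_prefix hm).trans ?_⟩
  -- The next standard word supplies a nonempty continuation, whose image starts with the a that
  -- completes φ.
  obtain ⟨r, hr, e⟩ := exists_shiftedStandardSeq_succ hd a b m
  rw [shiftedStandardSeq_eq_psi h0 h hab, e, psi_append]
  obtain ⟨c, r, rfl⟩ := List.exists_cons_of_ne_nil hr
  obtain ⟨z, hz⟩ := exists_psi_cons a c r
  exact ⟨z, by simp [SturmianOC.phi, hz]⟩

/-- The words `s_n u_n`, where `s_n` is `u_n` followed by two letters. -/
def IsStandardDoubling (d : ℕ → ℕ) (a b : A) (v : List A) : Prop :=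
  ∃ m u, shiftedStandardSeq d a b m = u ++ lastTwo a b (m + 1) ∧
    v = shiftedStandardSeq d a b m ++ u

@[simp] theorem length_lastTwo (a b : A) (n : ℕ) : (lastTwo a b n).length = 2 := by
  unfold lastTwo; split_ifs <;> rfl

theorem isStandardDoubling_swap {d : ℕ → ℕ} (h0 : d 0 = 0) {a b : A} {v : List A} :
    IsStandardDoubling d a b v ↔ IsStandardDoubling (fun n => d (n + 1)) b a v := by
  constructor
  · rintro ⟨m, u, h1, h2⟩
    cases m with
    | zero =>
      have := congrArg List.length h1
      simp [shiftedStandardSeq] at this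
    | succ m =>
      rw [shiftedStandardSeq_swap h0] at h1 h2
      exact ⟨m, u, by rw [h1, lastTwo_succ], h2⟩
  · rintro ⟨m, u, h1, h2⟩
    rw [← shiftedStandardSeq_swap h0] at h1 h2
    exact ⟨m + 1, u, by rw [h1, lastTwo_succ a b (m + 1)], h2⟩

theorem psi_lastTwo {a b : A} (hab : a ≠ b) (n : ℕ) :
    psi a (lastTwo a b n) = a :: lastTwo a b n := by
  unfold lastTwo
  split_ifs <;> simp [psi_cons_of_ne hab.symm]

/-- From s = uxy one gets ψ(s) = ψ(u)a·xy = φ(u)xy, because ψ(xy) = axy; and φ(su) = ψ(s)φ(u). -/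
theorem IsStandardDoubling.phi {d d' : ℕ → ℕ} (h0 : d 0 = d' 0 + 1)
    (h : ∀ n, d (n + 1) = d' (n + 1)) {a b : A} (hab : a ≠ b)
    {v : List A} (hv : IsStandardDoubling d' a b v) : IsStandardDoubling d a b (phi a v) := by
  obtain ⟨m, u, h1, h2⟩ := hv
  cases m with
  | zero =>
    have := congrArg List.length h1
    simp [shiftedStandardSeq] at this
  | succ m =>
    have e := shiftedStandardSeq_eq_psi h0 h hab m
    refine ⟨m + 1, SturmianOC.phi a u, ?_, ?_⟩
    · rw [e, h1, psi_append, psi_lastTwo hab]; simp [SturmianOC.phi]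
    · rw [e, h2, phi_append]

theorem exists_shiftedStandardSeq_eq_cons {d : ℕ → ℕ} (h0 : 1 ≤ d 0) (hd : ∀ n, 1 ≤ d (n + 1))
    (a b : A) (m : ℕ) : ∃ x, shiftedStandardSeq d a b (m + 1) = a :: x := by
  cases m with
  | zero => exact ⟨[], rfl⟩
  | succ m =>
    obtain ⟨r, hr⟩ := shiftedStandardSeq_prefix hd a b le_rfl (show 2 ≤ m + 2 by omega)
    obtain ⟨k, hk⟩ := Nat.exists_eq_add_of_le h0
    rw [shiftedStandardSeq, hk, Nat.add_comm 1 k, List.replicate_succ] at hr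
    exact ⟨_, hr.symm⟩

theorem IsStandardDoubling.eq_or_exists {d d' : ℕ → ℕ} (h0 : d 0 = d' 0 + 1)
    (h : ∀ n, d (n + 1) = d' (n + 1)) (hd : ∀ n, 1 ≤ d' (n + 1)) {a b : A} (hab : a ≠ b)
    {v : List A} (hv : IsStandardDoubling d a b v) :
    (v = [a, b] ∧ IsLimitPrefix d a b v) ∨
      ∃ v', v = SturmianOC.phi a v' ∧ IsStandardDoubling d' a b v' := by
  have hd' : ∀ n, 1 ≤ d (n + 1) := fun n => by rw [h]; exact hd n
  obtain ⟨m, u, h1, h2⟩ := hv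
  match m with
  | 0 => have := congrArg List.length h1; simp [shiftedStandardSeq] at this
  | 1 => have := congrArg List.length h1; simp [shiftedStandardSeq] at this
  | m + 2 =>
    rcases eq_or_ne u [] with rfl | hu
    · left
      rw [List.append_nil] at h2
      refine ⟨?_, m, h2 ▸ List.prefix_refl _⟩
      rw [h2, h1, List.nil_append]
      obtain ⟨x, hx⟩ := exists_shiftedStandardSeq_eq_cons (by omega) hd' a b (m + 1)
      rw [hx] at h1
      unfold lastTwo at h1 ⊢
      split_ifs at h1 ⊢
      · rfl
      · simp only [List.nil_append, List.cons.injEq] at h1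
        exact absurd h1.1 hab
    · right
      have e := shiftedStandardSeq_eq_psi h0 h hab (m + 1)
      obtain ⟨u', hu'⟩ : lastTwo a b (m + 2 + 1) <:+ shiftedStandardSeq d' a b (m + 2) := by
        apply lastTwo_suffix hd
        -- A preimage of at most one letter has an image of length at most 2, whereas u nonempty
        -- forces length at least 3.
        by_contra hlt
        have hl := congrArg List.length (e.symm.trans h1)
        have hu0 := List.length_pos_iff.2 hu
        simp only [List.length_append, length_lastTwo] at hl
        match hx : shiftedStandardSeq d' a b (m + 2) with
        | [] => simp [hx] at hl
        | [c] =>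
          rw [hx] at hl
          by_cases hc : c = a
          · subst hc; simp at hl
          · rw [psi_cons_of_ne hc] at hl; simp at hl; exact hu hl
        | _ :: _ :: _ => rw [hx] at hlt; simp at hlt
      have hu2 : u = SturmianOC.phi a u' := by
        have h3 := e.symm.trans h1
        rw [← hu', psi_append, psi_lastTwo hab, List.append_cons] at h3
        exact (List.append_cancel_right h3).symm
      exact ⟨shiftedStandardSeq d' a b (m + 2) ++ u', by rw [h2, e, phi_append, hu2],
        m + 2, u', hu'.symm, rfl⟩

theorem isSemicentral_pair {a b : A} (hab : a ≠ b) : IsSemicentral [a, b] := by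
  have hL : ∀ {a b : A}, a ≠ b → IsLeftCore [a, b] [] := by
    intro a b hab
    refine ⟨⟨⟨List.nil_prefix, [], [a, b], [a, b], [], by simp⟩, ?_⟩,
      ⟨a, b, hab, ⟨[], [b], rfl⟩, ⟨[a], [], rfl⟩⟩, ?_⟩
    · rintro t ⟨ht, p, z, p', z', h1, h2, hne⟩ ht0
      exfalso
      obtain ⟨c, t, rfl⟩ := List.exists_cons_of_ne_nil ht0
      obtain ⟨y, hy⟩ := ht
      simp only [List.cons_append, List.cons.injEq] at hy
      obtain ⟨rfl, -⟩ := hy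
      have key : ∀ p z, [c, b] = p ++ c :: t ++ z → p = [] := by
        intro p z h
        match p with
        | [] => rfl
        | [e] => simp at h; exact absurd h.2.1.symm hab
        | _ :: _ :: _ => simp at h
      exact hne ((key p z h1).trans (key p' z' h2).symm)
    · rintro t ⟨c, e, hce, h1, h2⟩ ht0
      exfalso
      obtain ⟨f, t, rfl⟩ := List.exists_cons_of_ne_nil ht0
      have key : ∀ c, (c :: f :: t) <:+: [a, b] → c = a := by
        rintro c ⟨p, z, h⟩
        match p with
        | [] => simp at h; exact h.1
        | _ :: p => have := congrArg List.length h; simp at this; omega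
      exact hce ((key c h1).trans (key e h2).symm)
  exact isSemicentral_iff.2 ⟨[], hL hab, hL hab.symm⟩

/-- A semicentral prefix of an image under `psi a` is a two-letter word or again an image. -/
theorem IsSemicentral.eq_or_exists {a : A} {x v : List A} (hv : IsSemicentral v)
    (hpre : v <+: SturmianOC.phi a x) (hx : LeftSpecialComparable x)
    (hxr : LeftSpecialComparable x.reverse) :
    (∃ c, c ≠ a ∧ v = [a, c]) ∨
      ∃ v', v = SturmianOC.phi a v' ∧ v' <+: x ∧ IsSemicentral v' := by
  obtain ⟨u, hL, hR⟩ := isSemicentral_iff.1 hv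
  have hv0 : v ≠ [] := by
    rintro rfl
    obtain ⟨c, e, -, h1, -⟩ := hL.2.1
    simpa using h1.length_le
  obtain ⟨e, y, rfl⟩ := List.exists_cons_of_ne_nil hv0
  obtain ⟨z, hz⟩ := exists_phi_eq_cons a x
  obtain rfl : e = a := by
    obtain ⟨r, hr⟩ := hpre
    rw [hz] at hr
    simp only [List.cons_append, List.cons.injEq] at hr
    exact hr.1
  rcases eq_or_ne u [] with rfl | hu
  · left
    -- A second occurrence of the first letter would be a nonempty repeated prefix. Any letter other
    -- than it is followed by it in the image, so at most one more letter fits.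
    have hay : e ∉ y := by
      intro hy
      obtain ⟨p, q, rfl⟩ := List.append_of_mem hy
      have := hL.1.2 [e] ⟨⟨_, rfl⟩, [], p ++ e :: q, e :: p, q, by simp, by simp, by simp⟩ (by simp)
      simp at this
    match y with
    | [] =>
      exfalso
      obtain ⟨c, f, hcf, h1, h2⟩ := hL.2.1
      have h1 := h1.subset (List.mem_cons_self)
      have h2 := h2.subset (List.mem_cons_self)
      simp only [List.mem_singleton] at h1 h2
      exact hcf (h1.trans h2.symm)
    | c :: y =>
      have hc : c ≠ e := fun h => hay (by simp [h])
      obtain ⟨r, hr⟩ := hpre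
      obtain ⟨-, R, hR⟩ := exists_of_phi_eq_append_cons_of_ne hc (v := x) (P := [e]) (R := y ++ r)
        (by rw [← hr]; simp)
      match y with
      | [] => exact ⟨c, hc, rfl⟩
      | f :: y =>
        simp only [List.cons_append, List.cons.injEq] at hR
        exact absurd (by simp [hR.1]) hay
  · right
    obtain ⟨u, g, rfl⟩ : ∃ u' g, u = u' ++ [g] := by
      rcases List.eq_nil_or_concat u with h | ⟨u', g, h⟩
      · exact absurd h hu
      · exact ⟨u', g, by simpa using h⟩
    obtain ⟨c, f, hcf, h1, h2⟩ := isLeftSpecial_reverse_iff.1 hR.2.1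
    -- The word u is right special, and a letter other than a can only be followed by a; so u ends
    -- in a. Being both a suffix and a prefix of v, it lets v and then u be cut at an a and
    -- desubstituted.
    have hg : g = e := by
      by_contra hg
      have key : ∀ c, (u ++ [g] ++ [c]) <:+: (e :: y) → c = e := by
        intro c hc
        obtain ⟨P, Z, hP⟩ := hc.trans hpre.isInfix
        obtain ⟨-, R, hR⟩ := exists_of_phi_eq_append_cons_of_ne hg (v := x) (P := P ++ u)
          (R := c :: Z) (by rw [← hP]; simp)
        simp only [List.cons.injEq] at hR
        exact hR.1
      exact hcf ((key c h1).trans (key f h2).symm)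
    subst hg
    have hsuf : u ++ [g] <:+ g :: y := (isRepeatedPrefix_reverse_iff.1 hR.1.1).1
    obtain ⟨p, hp⟩ := hsuf
    obtain ⟨r, hr⟩ := hpre
    obtain ⟨v', r', rfl, hv', -⟩ := exists_of_phi_eq_append_cons (a := g) (v := x) (P := p ++ u)
      (R := r) (by rw [← hr, ← hp]; simp)
    have hV : g :: y = SturmianOC.phi g v' := by
      rw [← hp, SturmianOC.phi, ← hv']; simp
    obtain ⟨q, hq⟩ : u ++ [g] <+: g :: y := hL.1.1.1
    obtain ⟨u', -, -, rfl, -⟩ := exists_of_phi_eq_append_cons (a := g) (v := v') (P := u)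
      (R := q) (by rw [← hV, ← hq]; simp)
    have hU : psi g u' ++ [g] = SturmianOC.phi g u' := rfl
    rw [hV, hU] at hL hR
    rw [phi_reverse, phi_reverse] at hR
    refine ⟨v', hV, List.prefix_append _ _, isSemicentral_iff.2 ⟨u', ?_, ?_⟩⟩
    · exact (isLeftCore_phi_iff (hx.of_infix (List.prefix_append _ _).isInfix)).1 hL
    · exact (isLeftCore_phi_iff (hxr.of_infix
        (List.reverse_infix.2 (List.prefix_append _ _).isInfix))).1 hR

theorem IsSemicentral.phi {v : List A} (hv : IsSemicentral v) (h : LeftSpecialComparable v)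
    (hr : LeftSpecialComparable v.reverse) (a : A) : IsSemicentral (phi a v) := by
  obtain ⟨u, hL, hR⟩ := isSemicentral_iff.1 hv
  refine isSemicentral_iff.2 ⟨SturmianOC.phi a u, (isLeftCore_phi_iff h).2 hL, ?_⟩
  rw [phi_reverse, phi_reverse]
  exact (isLeftCore_phi_iff hr).2 hR

/-- Since φ strictly lengthens words, length is the induction parameter. The digit d_0 may vanish
because lowering it can reach 0. -/
theorem isSemicentral_limitPrefix_iff (N : ℕ) : ∀ {d : ℕ → ℕ} {a b : A} {v : List A}, a ≠ b →
    (∀ n, 1 ≤ d (n + 1)) → v.length ≤ N →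
    ((IsLimitPrefix d a b v ∧ IsSemicentral v) ↔ IsStandardDoubling d a b v) := by
  induction N with
  | zero =>
    intro d a b v _ _ hv
    obtain rfl : v = [] := List.length_eq_zero_iff.1 (by omega)
    constructor
    · rintro ⟨-, u, -, -, ⟨⟨c, e, -, h1, -⟩, -⟩, -⟩
      simpa using h1.length_le
    · rintro ⟨m, u, h1, h2⟩
      rw [h1] at h2
      have := congrArg List.length h2
      simp at this
      omega
  | succ N ih =>
    -- Exchanging letters does not shorten v, but one exchange suffices since the next digit is
    -- positive.
    suffices hpos : ∀ {d : ℕ → ℕ} {a b : A} {v : List A}, a ≠ b → 1 ≤ d 0 →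
        (∀ n, 1 ≤ d (n + 1)) → v.length ≤ N + 1 →
        ((IsLimitPrefix d a b v ∧ IsSemicentral v) ↔ IsStandardDoubling d a b v) by
      intro d a b v hab hd hv
      rcases Nat.eq_zero_or_pos (d 0) with h0 | h0
      · rw [isLimitPrefix_swap hd h0, isStandardDoubling_swap h0]
        exact hpos hab.symm (hd 0) (fun n => hd (n + 1)) hv
      · exact hpos hab h0 hd hv
    intro d a b v hab hd0 hd hv
    obtain ⟨d', h0, h⟩ : ∃ d' : ℕ → ℕ, d 0 = d' 0 + 1 ∧ ∀ n, d (n + 1) = d' (n + 1) :=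
      ⟨Function.update d 0 (d 0 - 1), by simp; omega, by simp⟩
    have hd' : ∀ n, 1 ≤ d' (n + 1) := fun n => h n ▸ hd n
    have ih' := fun (v' : List A) (hv' : v = phi a v') => ih (d := d') (v := v') hab hd'
      (by have := length_lt_length_phi a v'; rw [← hv'] at this; omega)
    constructor
    · rintro ⟨⟨m, hm⟩, hsc⟩
      obtain ⟨h1, h2⟩ := leftSpecialComparable_shiftedStandardSeq (m + 2) d' hab
      have hm' := hm
      rw [shiftedStandardSeq_eq_psi h0 h hab] at hm'
      rcases hsc.eq_or_exists (hm'.trans (List.prefix_append _ [a])) h1 h2 with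
        ⟨c, hc, rfl⟩ | ⟨v', hv', hpre, hsc'⟩
      · have hcb : c = b := (mem_shiftedStandardSeq (hm.subset (by simp))).resolve_left hc
        subst hcb
        -- If d_0 ≥ 2 the limit starts with aa; so ab is a prefix only for d_0 = 1, and then it is
        -- s_1 with empty u.
        have hd1 : d' 0 = 0 := by
          by_contra hne
          obtain ⟨k, hk⟩ := Nat.exists_eq_succ_of_ne_zero hne
          obtain ⟨r, hr⟩ := shiftedStandardSeq_prefix hd a c le_rfl (show 2 ≤ m + 2 by omega)
          obtain ⟨r', hr'⟩ := hm
          rw [← hr, shiftedStandardSeq, h0, hk, List.replicate_succ, List.replicate_succ] at hr'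
          simp [shiftedStandardSeq] at hr'
          exact hc hr'.1
        exact ⟨2, [], by simp [shiftedStandardSeq, h0, hd1, lastTwo, show Odd 3 by decide],
          by simp [shiftedStandardSeq, h0, hd1]⟩
      · rw [hv']
        exact ((ih' v' hv').1 ⟨⟨m, hpre⟩, hsc'⟩).phi h0 h hab
    · intro hdbl
      rcases hdbl.eq_or_exists h0 h hd' hab with ⟨rfl, hlim⟩ | ⟨v', hv', hdbl'⟩
      · exact ⟨hlim, isSemicentral_pair hab⟩
      · obtain ⟨hlim, hsc⟩ := (ih' v' hv').2 hdbl'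
        rw [hv']
        refine ⟨hlim.phi h0 h hd' hab, ?_⟩
        obtain ⟨m, hm⟩ := hlim
        obtain ⟨h1, h2⟩ := leftSpecialComparable_shiftedStandardSeq (m + 2) d' hab
        exact hsc.phi (h1.of_infix hm.isInfix) (h2.of_infix (List.reverse_infix.2 hm.isInfix)) a

/-! ### The slope -/

theorem one_le_slopeDigit_succ {α : ℝ} (hα : Irrational α) (n : ℕ) : 1 ≤ slopeDigit α (n + 1) :=
  partialQuotient_pos hα (n + 1)

theorem one_le_slopeDigit_zero {α : ℝ} (hpos : 0 < α) (hlt : α < 1 / 2) :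
    1 ≤ slopeDigit α 0 := by
  have hfr : Int.fract α = α := Int.fract_eq_self.2 ⟨hpos.le, by linarith⟩
  have hhead := GenContFract.of_s_head (v := α) (by rw [hfr]; exact hpos.ne')
  rw [hfr] at hhead
  have hden : (GenContFract.of α).partDens.get? 0 = some (⌊α⁻¹⌋ : ℝ) :=
    GenContFract.partDen_eq_s_b hhead
  -- The first partial quotient is d_0 + 1, so α < 1/2 is what makes d_0 positive.
  have h2 : (2 : ℤ) ≤ ⌊α⁻¹⌋ := by
    rw [Int.le_floor]
    push_cast
    rw [le_inv_comm₀ two_pos hpos]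
    linarith
  have h3 : 2 ≤ partialQuotient α 0 := by
    rw [partialQuotient, hden, Option.getD_some]
    exact Nat.le_floor (by exact_mod_cast h2)
  show 1 ≤ partialQuotient α 0 - 1
  omega

theorem isPrefixOf_iff_isLimitPrefix {α : ℝ} (hα : Irrational α) {a b : A} {w : ℕ → A}
    (hw : IsStandardSturmianWord α a b w) (v : List A) :
    IsPrefixOf v w ↔ IsLimitPrefix (slopeDigit α) a b v := by
  constructor
  · intro hv
    -- Only finitely many positions matter, so a single standard word agrees with the limit at all
    -- of them.
    have h1 : ∀ᶠ n in Filter.atTop, ∀ k ∈ Finset.range v.length,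
        (standardSeq α a b n)[k]? = some (w k) :=
      (Filter.eventually_all_finset _).2 fun k _ => hw k
    obtain ⟨n, hn, hn1⟩ := (h1.and (Filter.eventually_ge_atTop 1)).exists
    obtain ⟨m, rfl⟩ : ∃ m, n = m + 1 := ⟨n - 1, by omega⟩
    refine ⟨m, List.prefix_iff_getElem?.2 fun i hi => ?_⟩
    rw [hv i hi]
    exact hn i (Finset.mem_range.2 hi)
  · rintro ⟨m, hm⟩ i hi
    obtain ⟨n, hn, hn1⟩ := ((hw i).and (Filter.eventually_ge_atTop (m + 1))).exists
    have hp : v <+: standardSeq α a b n := hm.trans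
      (shiftedStandardSeq_prefix (one_le_slopeDigit_succ hα) a b (by omega) (by omega))
    have := List.prefix_iff_getElem?.1 hp i hi
    rw [hn] at this
    exact (Option.some.inj this).symm

end SturmianOC

theorem mainTheorem11 {A : Type*} (a b : A) (hab : a ≠ b)
    (α : ℝ) (hirr : Irrational α) (hpos : 0 < α) (hlt : α < 1 / 2)
    (w : ℕ → A) (hw : SturmianOC.IsStandardSturmianWord α a b w) :
    (∀ n : ℕ, 1 ≤ n →
      SturmianOC.standardSeq α a b n =
        SturmianOC.centralPrefix α a b n ++ SturmianOC.lastTwo a b n) ∧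
    (∀ v : List A,
      (SturmianOC.IsPrefixOf v w ∧ SturmianOC.IsSemicentral v) ↔
        ∃ n : ℕ, 1 ≤ n ∧
          v = SturmianOC.centralPrefix α a b n ++ SturmianOC.lastTwo a b n ++
            SturmianOC.centralPrefix α a b n) := by
  have hd := SturmianOC.one_le_slopeDigit_succ hirr
  have hd0 := SturmianOC.one_le_slopeDigit_zero hpos hlt
  have hdrop : ∀ (u : List A) (n : ℕ), (u ++ SturmianOC.lastTwo a b n).dropLast.dropLast = u := by
    intro u n
    unfold SturmianOC.lastTwo
    split_ifs <;> simp [List.dropLast_append_of_ne_nil]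
  have hfst : ∀ n : ℕ, 1 ≤ n → SturmianOC.standardSeq α a b n =
      SturmianOC.centralPrefix α a b n ++ SturmianOC.lastTwo a b n := by
    intro n hn
    obtain ⟨m, rfl⟩ : ∃ m, n = m + 1 := ⟨n - 1, by omega⟩
    obtain ⟨u, hu⟩ := SturmianOC.lastTwo_suffix_of_pos
      (fun n => by cases n with | zero => exact hd0 | succ n => exact hd n) a b m
    rw [show m + 3 = m + 1 + 2 from rfl, SturmianOC.lastTwo_add_two] at hu
    have hs : SturmianOC.standardSeq α a b (m + 1) = u ++ SturmianOC.lastTwo a b (m + 1) :=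
      hu.symm
    rw [SturmianOC.centralPrefix, hs, hdrop]
  refine ⟨hfst, fun v => ?_⟩
  rw [SturmianOC.isPrefixOf_iff_isLimitPrefix hirr hw,
    SturmianOC.isSemicentral_limitPrefix_iff v.length hab hd le_rfl]
  constructor
  · rintro ⟨m, u, h1, rfl⟩
    -- Shifted indices 0 and 1 are the single letters s_(-1) and s_0, too short to end in two
    -- letters.
    match m with
    | 0 => have := congrArg List.length h1; simp [SturmianOC.shiftedStandardSeq] at this
    | 1 => have := congrArg List.length h1; simp [SturmianOC.shiftedStandardSeq] at this
    | m + 2 =>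
      rw [show m + 2 + 1 = m + 1 + 2 from rfl, SturmianOC.lastTwo_add_two] at h1
      have hs : SturmianOC.standardSeq α a b (m + 1) = u ++ SturmianOC.lastTwo a b (m + 1) := h1
      refine ⟨m + 1, by omega, ?_⟩
      rw [SturmianOC.centralPrefix, hs, hdrop, h1]
  · rintro ⟨n, hn, rfl⟩
    refine ⟨n + 1, SturmianOC.centralPrefix α a b n, ?_, ?_⟩
    · rw [show n + 1 + 1 = n + 2 from rfl, SturmianOC.lastTwo_add_two]
      exact hfst n hn
    · rw [← hfst n hn]; rfl
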